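/- Let $n\ge 2$ and $0\le k\le n/2$, and let $\lambda=(n-k,k)$ (read as $(n)$ if $k=0$). Let $X^\lambda$ be the set of tabloids of shape $\lambda$ with entries $1,\dots,n$ (row-equivalence classes of Young tableaux of shape $\lambda$), on which $S_n$ acts by permuting entries, and let $\mathbb{C}X^\lambda$ be the space of functions $X^\lambda\to\mathbb{C}$ with the action $(g f)(x)=f(g^{-1}x)$. Let $S_1<\dots<S_n$ be the chain in which $S_j$ consists of the permutations of $\{1,\dots,n\}$ fixing $j+1,\dots,n$. For each $1\le j\le n$ let $\mathcal{R}(S_j)$ be a maximal set of pairwise inequivalent irreducible complex matrix representations of $S_j$. A basis $\mathcal{B}$ of $\mathbb{C}X^\lambda$ is *symmetry adapted* with respect to $\mathcal{R}(S_i)$ if, for a suitable arrangement of $\mathcal{B}$ into blocks not depending on $g$, the matrix $[g]_{\mathcal{B}}$ is for every $g\in S_i$ block diagonal with blocks of the form $\rho(g)$, $\rho\in\mathcal{R}(S_i)$, where $\rho$ depends on the block but not on $g$. Suppose that $\mathcal{R}(S_1),\dots,\mathcal{R}(S_n)$ are compatible with respect to $\mathbb{C}X^\lambda$, i.e. some basis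 of $\mathbb{C}X^\lambda$ is symmetry adapted with respect to all of them simultaneously. Let $\mathcal{B}_1,\dots,\mathcal{B}_n$ be bases of $\mathbb{C}X^\lambda$ such that $\mathcal{B}_1$ is the standard basis (the indicator functions of points) and, for every $1\le j\le n$, $\mathcal{B}_j$ is an orbital symmetry adapted basis with respect to $\mathcal{R}(S_1),\dots,\mathcal{R}(S_j)$: it is symmetry adapted with respect to each of $\mathcal{R}(S_1),\dots,\mathcal{R}(S_j)$, and it can be partitioned into subsets which, for the $S_j$-orbits $Y$ on $X^\lambda$, are harmonic bases of the subspaces $\mathbb{C}Y$ of functions supported on $Y$ (a basis of $\mathbb{C}Y$ is harmonic if it can be partitioned into bases of irreducible $\mathbb{C}S_j$-submodules). Let $C(\mathcal{B}_n,\mathcal{B}_1)$ be the matrix with $C(\mathcal{B}_n,\mathcal{B}_1)[f]_{\mathcal{B}_1}=[f]_{\mathcal{B}_n}$ for all $f\in\mathbb{C}X^\lambda$, and for a square complex matrix $A$ let $\omega(A)$ be the least number of arithmetic operations (additions, and multiplications by complex constants) in a straight-line computation of $Ax$ from an arbitrary vector $x$. Then $$\omega(C(\mathcal{B}_n,\mathcal{B}_1))<4(n-1)\binom{n}{k}.$$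 -/

import Mathlib

namespace HarmonicTabloids

noncomputable section

open Module

/-! ### Matrix representations and complete systems `R(G)` -/

/-- A complex matrix representation of `G`: a degree `d` and a homomorphism from `G` to
`d × d` complex matrices. -/
structure MatrixRep (G : Type*) [Group G] where
  deg : ℕ
  mat : G →* Matrix (Fin deg) (Fin deg) ℂ

/-- The representation of `G` on `ℂ^d` given by a matrix representation. -/
def MatrixRep.toRepresentation {G : Type*} [Group G] (σ : MatrixRep G) :
    Representation ℂ G (Fin σ.deg → ℂ) :=
  (Matrix.toLinAlgEquiv' : Matrix (Fin σ.deg) (Fin σ.deg) ℂ ≃ₐ[ℂ] _).toAlgHom.toMonoidHom.comp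
    σ.mat

/-- `R` is a maximal set of pairwise inequivalent irreducible complex matrix representations
of `G`. -/
structure IsCompleteSystem {G : Type*} [Group G] (R : Set (MatrixRep G)) : Prop where
  irreducible : ∀ σ ∈ R, σ.toRepresentation.IsIrreducible
  inequivalent : ∀ σ ∈ R, ∀ τ ∈ R,
    Nonempty (σ.toRepresentation.Equiv τ.toRepresentation) → σ = τ
  exhaustive : ∀ τ : MatrixRep G, τ.toRepresentation.IsIrreducible →
    ∃ σ ∈ R, Nonempty (σ.toRepresentation.Equiv τ.toRepresentation)

/-! ### Symmetry adapted bases, compatibility -/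

section Bases

variable {G V : Type*} [Group G] [AddCommGroup V] [Module ℂ V]

/-- The restriction of a representation to a subgroup. -/
def res (ρ : Representation ℂ G V) (H : Subgroup G) : Representation ℂ H V :=
  ρ.comp H.subtype

/-- The basis `B` is symmetry adapted with respect to `R`: after arranging the basis vectors in
blocks (by `e`, the same for all `g`), the matrix of every `g` is block diagonal, and its blocks
are of the form `σ(g)` with `σ ∈ R`. -/
def IsSymmetryAdapted {m : ℕ} (R : Set (MatrixRep G)) (ρ : Representation ℂ G V)
    (B : Basis (Fin m) ℂ V) : Prop :=
  ∃ (t : ℕ) (σ : Fin t → MatrixRep G) (e : Fin m ≃ Σ s : Fin t, Fin (σ s).deg),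
    (∀ s, σ s ∈ R) ∧
    ∀ g : G, LinearMap.toMatrix (B.reindex e) (B.reindex e) (ρ g) =
      Matrix.blockDiagonal' fun s => (σ s).mat g

/-- `B` is symmetry adapted with respect to the list `R 1, …, R j`, where `R i` consists of
representations of the subgroup `H i`. -/
def IsSymmetryAdaptedList {m : ℕ} (H : ℕ → Subgroup G) (R : ∀ i, Set (MatrixRep (H i))) (j : ℕ)
    (ρ : Representation ℂ G V) (B : Basis (Fin m) ℂ V) : Prop :=
  ∀ i, 1 ≤ i → i ≤ j → IsSymmetryAdapted (R i) (res ρ (H i)) B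

/-- `R 1, …, R n` are compatible with respect to the representation `ρ` of `G`. -/
def IsCompatible (H : ℕ → Subgroup G) (R : ∀ i, Set (MatrixRep (H i))) (n : ℕ)
    (ρ : Representation ℂ G V) : Prop :=
  ∃ (m : ℕ) (B : Basis (Fin m) ℂ V), IsSymmetryAdaptedList H R n ρ B

/-- The family `b` is a harmonic basis of the subspace `W`: it is a basis of `W`, and its index
set can be partitioned so that each part spans an irreducible subrepresentation. -/
def IsHarmonicBasisOf {κ : Type*} (ρ : Representation ℂ G V) (b : κ → V)
    (W : Submodule ℂ V) : Prop :=
  LinearIndependent ℂ b ∧ Submodule.span ℂ (Set.range b) = W ∧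
    ∃ (t : ℕ) (c : κ → Fin t), ∀ s : Fin t, ∃ U : Subrepresentation ρ,
      U.toRepresentation.IsIrreducible ∧ U.toSubmodule = Submodule.span ℂ (b '' {i | c i = s})

end Bases

/-! ### Permutation modules and orbital bases -/

section Permutation

variable {G : Type*} [Group G] (X : Type*) [MulAction G X]

/-- The permutation representation of `G` on the functions `X → ℂ`: `(g f)(x) = f(g⁻¹ x)`. -/
def permRep (G : Type*) [Group G] (X : Type*) [MulAction G X] :
    Representation ℂ G (X → ℂ) where
  toFun g := LinearMap.funLeft ℂ ℂ fun x : X => g⁻¹ • x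
  map_one' := by
    ext f x
    simp [LinearMap.funLeft]
  map_mul' g h := by
    ext f x
    simp [LinearMap.funLeft, mul_smul]

variable {X}

/-- The subspace of functions on `X` that vanish outside the orbit `q` of `H`. -/
def orbitSpace (H : Subgroup G) (q : MulAction.orbitRel.Quotient H X) : Submodule ℂ (X → ℂ) where
  carrier := {f | ∀ x, x ∉ q.orbit → f x = 0}
  zero_mem' := fun _ _ => rfl
  add_mem' := fun {f g} hf hg x hx => by simp [hf x hx, hg x hx]
  smul_mem' := fun c f hf x hx => by simp [hf x hx]

/-- `B` is an orbital harmonic basis for the action of `H` on `X`: it can be partitioned into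
subsets that form harmonic bases of the spaces of functions on the orbits. -/
def IsOrbitalHarmonic {m : ℕ} (H : Subgroup G) (B : Basis (Fin m) ℂ (X → ℂ)) : Prop :=
  ∃ o : Fin m → MulAction.orbitRel.Quotient H X, ∀ q : MulAction.orbitRel.Quotient H X,
    IsHarmonicBasisOf (res (permRep G X) H) (fun i : {i // o i = q} => B i) (orbitSpace H q)

/-- `B` is an orbital symmetry adapted basis with respect to `R 1, …, R j`; the orbits are those
of the largest group `H j`. -/
def IsOrbitalSymmetryAdapted {m : ℕ} (H : ℕ → Subgroup G) (R : ∀ i, Set (MatrixRep (H i)))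
    (j : ℕ) (B : Basis (Fin m) ℂ (X → ℂ)) : Prop :=
  IsOrbitalHarmonic (H j) B ∧ IsSymmetryAdaptedList H R j (permRep G X) B

open Classical in
/-- `B` is the standard basis, consisting of the indicator functions of the points of `X`, in
some enumeration. -/
def IsStandardBasis {m : ℕ} (B : Basis (Fin m) ℂ (X → ℂ)) : Prop :=
  ∃ e : Fin m ≃ X, ∀ i, B i = Pi.single (e i) 1

end Permutation

/-! ### Tabloids -/

/-- A Young tableau of shape `α` with entries `Fin n`: a filling of the boxes `(i, c)`, with
`c < α i`, by the elements of `Fin n` without repetition. -/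
abbrev Tableau {r : ℕ} (α : Fin r → ℕ) (n : ℕ) := (Σ i : Fin r, Fin (α i)) ≃ Fin n

/-- The set of entries in row `i` of a tableau. -/
def rowSet {r n : ℕ} {α : Fin r → ℕ} (T : Tableau α n) (i : Fin r) : Set (Fin n) :=
  Set.range fun c : Fin (α i) => T ⟨i, c⟩

/-- Row equivalence of tableaux. -/
def rowSetoid {r : ℕ} (α : Fin r → ℕ) (n : ℕ) : Setoid (Tableau α n) where
  r T T' := ∀ i, rowSet T i = rowSet T' i
  iseqv := ⟨fun _ _ => rfl, fun h i => (h i).symm, fun h h' i => (h i).trans (h' i)⟩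

/-- Tabloids of shape `α`: the row equivalence classes of tableaux of shape `α`. -/
def Tabloid {r : ℕ} (α : Fin r → ℕ) (n : ℕ) := Quotient (rowSetoid α n)

theorem rowSet_trans {r n : ℕ} {α : Fin r → ℕ} (T : Tableau α n) (g : Equiv.Perm (Fin n))
    (i : Fin r) : rowSet (T.trans g) i = g '' rowSet T i := by
  unfold rowSet
  rw [← Set.range_comp]
  rfl

/-- A permutation acts on a tabloid by acting on the entries. -/
instance {r : ℕ} (α : Fin r → ℕ) (n : ℕ) : MulAction (Equiv.Perm (Fin n)) (Tabloid α n) where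
  smul g := Quotient.map (sa := rowSetoid α n) (sb := rowSetoid α n) (fun T => T.trans g)
    fun T T' (h : ∀ i, rowSet T i = rowSet T' i) i => by
      rw [rowSet_trans, rowSet_trans, h i]
  one_smul x := by
    induction x using Quotient.inductionOn
    rfl
  mul_smul g h x := by
    induction x using Quotient.inductionOn
    rfl

/-- `S_j` inside `S_n`: the permutations that fix every entry beyond the first `j`. -/
def symSubgroup (n j : ℕ) : Subgroup (Equiv.Perm (Fin n)) :=
  fixingSubgroup (Equiv.Perm (Fin n)) {i : Fin n | j ≤ (i : ℕ)}

/-! ### Operation counts -/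

/-- `Computes s S`: there is a straight-line computation with `s` arithmetic operations such that
`S` is the set of all quantities available at its end, as functions of the input vector. Initially
the coordinates of the input are available; each operation adds two available quantities, or
multiplies an available quantity by a complex constant. -/
inductive Computes {ι : Type*} : ℕ → Set ((ι → ℂ) → ℂ) → Prop
  | input : Computes 0 (Set.range fun (i : ι) (x : ι → ℂ) => x i)
  | add {s : ℕ} {S : Set ((ι → ℂ) → ℂ)} {f g : (ι → ℂ) → ℂ} (h : Computes s S)
      (hf : f ∈ S) (hg : g ∈ S) : Computes (s + 1) (insert (fun x => f x + g x) S)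
  | mul {s : ℕ} {S : Set ((ι → ℂ) → ℂ)} {f : (ι → ℂ) → ℂ} (h : Computes s S)
      (c : ℂ) (hf : f ∈ S) : Computes (s + 1) (insert (fun x => c * f x) S)

/-- `ω(A)`: the least number of arithmetic operations of a computation that produces all entries
of `A x` from the entries of an arbitrary vector `x`; it would be `⊤` if there were none. -/
def omega {m : ℕ} (A : Matrix (Fin m) (Fin m) ℂ) : ℕ∞ :=
  ⨅ (s : ℕ) (_ : ∃ S, Computes s S ∧ ∀ i, (fun x => A.mulVec x i) ∈ S), (s : ℕ∞)

/-- The change of basis matrix from `B'` to `B`: `C(B, B') [v]_{B'} = [v]_B`. -/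
def changeOfBasis {V : Type*} [AddCommGroup V] [Module ℂ V] {m : ℕ}
    (B B' : Basis (Fin m) ℂ V) : Matrix (Fin m) (Fin m) ℂ :=
  B.toMatrix B'

end

end HarmonicTabloids

namespace HarmonicTabloids

noncomputable section

open Module

/-! The matrix factors as the product of the `C(B_{j+1}, B_j)` for `1 ≤ j < n`, and each factor has
at most two nonzero entries per row. Both bases are adapted to the same `R(S_j)`, so by Schur's
lemma (`label_eq_of_repr_ne_zero`) an entry vanishes unless row and column carry the same
irreducible representation and the same position in it. The row vector lives on one `S_{j+1}`-orbit,
which splits into at most two `S_j`-orbits (`orbit_eq_or_orbit_eq`), and the column vector must live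
on one of these. On a single `S_j`-orbit the permutation module is multiplicity free, because any
two points of it are interchanged by a group element (Gelfand's trick, `comp_comm_of_equivariant`).
Hence each of the two orbits contributes at most one column (`index_eq_of_label_eq`). A row thus
costs two multiplications and one addition, so `3(n-1)` operations per basis vector suffice, and
there are at most `n.choose k` basis vectors. -/

theorem MatrixRep.toRepresentation_apply {G : Type*} [Group G] (σ : MatrixRep G) (g : G)
    (v : Fin σ.deg → ℂ) : σ.toRepresentation g v = (σ.mat g).mulVec v := rfl

/-- Schur's lemma for a system of inequivalent irreducible matrix representations, in
coordinates. -/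
theorem IsCompleteSystem.label_eq {G : Type*} [Group G] {R : Set (MatrixRep G)}
    (hR : IsCompleteSystem R) {σ τ : MatrixRep G} (hσ : σ ∈ R) (hτ : τ ∈ R)
    (F : (Fin τ.deg → ℂ) →ₗ[ℂ] (Fin σ.deg → ℂ))
    (hF : ∀ g v, F ((τ.mat g).mulVec v) = (σ.mat g).mulVec (F v))
    {p : Fin σ.deg} {q : Fin τ.deg} (h : F (Pi.single q 1) p ≠ 0) :
    (⟨σ, p⟩ : Σ ρ : MatrixRep G, Fin ρ.deg) = ⟨τ, q⟩ := by
  have := hR.irreducible σ hσ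
  have := hR.irreducible τ hτ
  let f : τ.toRepresentation.IntertwiningMap σ.toRepresentation :=
    F.intertwiningMap_of_isIntertwiningMap _ _ hF
  have hf : ∀ v, f v = F v := fun _ => rfl
  rcases Representation.IsIrreducible.bijective_or_eq_zero f with hb | h0
  · obtain rfl := hR.inequivalent τ hτ σ hσ ⟨f.ofBijective hb⟩
    -- Over `ℂ` the intertwiner is a scalar, so its off-diagonal entries vanish; this forces equal
    -- positions as well as equal types.
    obtain ⟨c, hc⟩ := (Representation.IsIrreducible.algebraMap_intertwiningMap_bijective_of_isAlgClosed
      (ρ := τ.toRepresentation)).2 f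
    have hF' : F (Pi.single q 1) p = c * (Pi.single q 1 : Fin τ.deg → ℂ) p := by
      rw [← hf, ← hc]
      rfl
    by_cases hpq : p = q
    · rw [hpq]
    · simp [hF', Pi.single_eq_of_ne hpq] at h
  · rw [← hf, h0] at h
    exact absurd rfl h

/-! ### Blocks of a symmetry adapted basis as intertwiners -/

section Blocks

variable {G V : Type*} [Group G] [AddCommGroup V] [Module ℂ V] {t : ℕ} {σ : Fin t → MatrixRep G}

/-- The vector with given coordinates in one block of a basis. -/
def blockMap (b : Basis (Σ s : Fin t, Fin (σ s).deg) ℂ V) (s : Fin t) :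
    (Fin (σ s).deg → ℂ) →ₗ[ℂ] V :=
  Fintype.linearCombination ℂ fun p => b ⟨s, p⟩

/-- The coordinates of a vector in one block of a basis. -/
def blockCoord (b : Basis (Σ s : Fin t, Fin (σ s).deg) ℂ V) (s : Fin t) :
    V →ₗ[ℂ] (Fin (σ s).deg → ℂ) :=
  LinearMap.pi fun p => b.coord ⟨s, p⟩

theorem blockMap_single (b : Basis (Σ s : Fin t, Fin (σ s).deg) ℂ V) (s : Fin t)
    (p : Fin (σ s).deg) : blockMap b s (Pi.single p 1) = b ⟨s, p⟩ := by
  simp [blockMap]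

theorem blockCoord_apply (b : Basis (Σ s : Fin t, Fin (σ s).deg) ℂ V) (s : Fin t) (v : V)
    (p : Fin (σ s).deg) : blockCoord b s v p = b.repr v ⟨s, p⟩ := rfl

theorem blockCoord_self (b : Basis (Σ s : Fin t, Fin (σ s).deg) ℂ V) (s : Fin t)
    (p : Fin (σ s).deg) : blockCoord b s (b ⟨s, p⟩) = Pi.single p 1 := by
  ext q
  rw [blockCoord_apply, b.repr_self, Finsupp.single_apply, Pi.single_apply]
  simp [eq_comm]

theorem blockCoord_of_ne (b : Basis (Σ s : Fin t, Fin (σ s).deg) ℂ V) {s s' : Fin t}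
    (h : s ≠ s') (p : Fin (σ s').deg) : blockCoord b s (b ⟨s', p⟩) = 0 := by
  ext q
  rw [blockCoord_apply, b.repr_self, Finsupp.single_apply, if_neg]
  · rfl
  · rintro h'
    exact h (congrArg Sigma.fst h').symm

variable {ρ : Representation ℂ G V} {b : Basis (Σ s : Fin t, Fin (σ s).deg) ℂ V}

theorem apply_eq_blockMap
    (hb : ∀ g, LinearMap.toMatrix b b (ρ g) = Matrix.blockDiagonal' fun s => (σ s).mat g)
    (g : G) (s : Fin t) (p : Fin (σ s).deg) :
    ρ g (b ⟨s, p⟩) = blockMap b s (((σ s).mat g).mulVec (Pi.single p 1)) := by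
  rw [← b.sum_repr (ρ g (b ⟨s, p⟩)), Fintype.sum_sigma, Finset.sum_eq_single s]
  · simp only [blockMap, Fintype.linearCombination_apply]
    refine Finset.sum_congr rfl fun q _ => ?_
    rw [← LinearMap.toMatrix_apply, hb, Matrix.blockDiagonal'_apply_eq]
    simp
  · intro s' _ hs'
    refine Finset.sum_eq_zero fun q _ => ?_
    rw [← LinearMap.toMatrix_apply, hb, Matrix.blockDiagonal'_apply_ne _ _ _ hs', zero_smul]
  · simp

theorem apply_blockMap
    (hb : ∀ g, LinearMap.toMatrix b b (ρ g) = Matrix.blockDiagonal' fun s => (σ s).mat g)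
    (g : G) (s : Fin t) (v : Fin (σ s).deg → ℂ) :
    ρ g (blockMap b s v) = blockMap b s (((σ s).mat g).mulVec v) := by
  have : ρ g ∘ₗ blockMap b s = blockMap b s ∘ₗ ((σ s).mat g).mulVecLin := by
    refine (Pi.basisFun ℂ _).ext fun p => ?_
    simp only [Pi.basisFun_apply, LinearMap.comp_apply, blockMap_single, Matrix.mulVecLin_apply]
    exact apply_eq_blockMap hb g s p
  exact LinearMap.congr_fun this v

theorem blockCoord_blockMap (s : Fin t) (v : Fin (σ s).deg → ℂ) :
    blockCoord b s (blockMap b s v) = v := by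
  have : blockCoord b s ∘ₗ blockMap b s = LinearMap.id := by
    refine (Pi.basisFun ℂ _).ext fun p => ?_
    simp [blockMap_single, blockCoord_self]
  exact LinearMap.congr_fun this v

theorem blockCoord_blockMap_of_ne {s s' : Fin t} (h : s ≠ s') (v : Fin (σ s').deg → ℂ) :
    blockCoord b s (blockMap b s' v) = 0 := by
  have : blockCoord b s ∘ₗ blockMap b s' = 0 := by
    refine (Pi.basisFun ℂ _).ext fun p => ?_
    simp [blockMap_single, blockCoord_of_ne b h]
  exact LinearMap.congr_fun this v

theorem blockCoord_apply_rep
    (hb : ∀ g, LinearMap.toMatrix b b (ρ g) = Matrix.blockDiagonal' fun s => (σ s).mat g)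
    (g : G) (s : Fin t) (v : V) :
    blockCoord b s (ρ g v) = ((σ s).mat g).mulVec (blockCoord b s v) := by
  have : blockCoord b s ∘ₗ ρ g = ((σ s).mat g).mulVecLin ∘ₗ blockCoord b s := by
    refine b.ext fun ⟨s', p⟩ => ?_
    simp only [LinearMap.comp_apply, Matrix.mulVecLin_apply, apply_eq_blockMap hb]
    by_cases h : s = s'
    · subst h
      rw [blockCoord_blockMap, blockCoord_self]
    · rw [blockCoord_blockMap_of_ne h, blockCoord_of_ne b h, Matrix.mulVec_zero]
  exact LinearMap.congr_fun this v

/-- A block of an irreducible type lies in every invariant subspace that contains one of its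
basis vectors. -/
theorem block_mem_of_mem
    (hb : ∀ g, LinearMap.toMatrix b b (ρ g) = Matrix.blockDiagonal' fun s => (σ s).mat g)
    {s : Fin t} (hs : (σ s).toRepresentation.IsIrreducible) {W : Submodule ℂ V}
    (hW : ∀ g, ∀ v ∈ W, ρ g v ∈ W) {p : Fin (σ s).deg} (hp : b ⟨s, p⟩ ∈ W)
    (q : Fin (σ s).deg) : b ⟨s, q⟩ ∈ W := by
  -- The pullback of `W` to the block's coordinates is a subrepresentation; irreducibility leaves
  -- only zero, excluded by the vector at `p`, or everything.
  let U : Subrepresentation (σ s).toRepresentation :=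
    ⟨W.comap (blockMap b s), fun g v hv => by
      rw [Submodule.mem_comap, MatrixRep.toRepresentation_apply, ← apply_blockMap hb]
      exact hW g _ hv⟩
  have hU : ∀ v, v ∈ U.toSubmodule ↔ blockMap b s v ∈ W := fun _ => Iff.rfl
  rcases eq_bot_or_eq_top U with h | h
  · have : (Pi.single p 1 : Fin (σ s).deg → ℂ) ∈ U.toSubmodule := by
      rw [hU, blockMap_single]
      exact hp
    rw [h] at this
    have h0 : (Pi.single p 1 : Fin (σ s).deg → ℂ) = 0 := this
    simp at h0
  · have : (Pi.single q 1 : Fin (σ s).deg → ℂ) ∈ U.toSubmodule := by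
      rw [h]
      trivial
    rwa [hU, blockMap_single] at this

/-- The matrix that changes one symmetry adapted basis into another one vanishes except where the
irreducible representations and the positions within them agree. -/
theorem label_eq_of_repr_ne_zero {R : Set (MatrixRep G)} (hR : IsCompleteSystem R) {t' : ℕ}
    {σ' : Fin t' → MatrixRep G} {b' : Basis (Σ s : Fin t', Fin (σ' s).deg) ℂ V}
    (hσ : ∀ s, σ s ∈ R) (hσ' : ∀ s, σ' s ∈ R)
    (hb : ∀ g, LinearMap.toMatrix b b (ρ g) = Matrix.blockDiagonal' fun s => (σ s).mat g)
    (hb' : ∀ g, LinearMap.toMatrix b' b' (ρ g) = Matrix.blockDiagonal' fun s => (σ' s).mat g)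
    {x : Σ s : Fin t, Fin (σ s).deg} {y : Σ s : Fin t', Fin (σ' s).deg}
    (h : b.repr (b' y) x ≠ 0) :
    (⟨σ x.1, x.2⟩ : Σ ρ : MatrixRep G, Fin ρ.deg) = ⟨σ' y.1, y.2⟩ := by
  -- Including a block of `b'` and projecting to a block of `b` is an intertwiner whose matrix
  -- entries are the entries of the change of basis.
  refine hR.label_eq (hσ _) (hσ' _) (blockCoord b x.1 ∘ₗ blockMap b' y.1) (fun g v => ?_) ?_
  · rw [LinearMap.comp_apply, ← apply_blockMap hb', blockCoord_apply_rep hb]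
    rfl
  · rw [LinearMap.comp_apply, blockMap_single]
    exact h

end Blocks

theorem MatrixRep.exists_cast {G : Type*} [Group G] {σ τ : MatrixRep G} {p : Fin σ.deg}
    {q : Fin τ.deg} (h : (⟨σ, p⟩ : Σ ρ : MatrixRep G, Fin ρ.deg) = ⟨τ, q⟩) :
    ∃ c : (Fin σ.deg → ℂ) ≃ₗ[ℂ] (Fin τ.deg → ℂ),
      ∀ g v, c ((σ.mat g).mulVec v) = (τ.mat g).mulVec (c v) := by
  obtain rfl := congrArg Sigma.fst h
  exact ⟨LinearEquiv.refl ℂ _, fun _ _ => rfl⟩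

/-! ### Multiplicity-freeness on symmetric orbits -/

section Kernels

variable {G X : Type*} [Group G] [MulAction G X] {H : Subgroup G}

theorem res_permRep_apply (g : H) (f : X → ℂ) (x : X) :
    res (permRep G X) H g f x = f ((g : G)⁻¹ • x) := rfl

theorem res_permRep_single [DecidableEq X] (g : H) (y : X) :
    res (permRep G X) H g (Pi.single y 1) = Pi.single ((g : G) • y) 1 := by
  ext x
  rw [res_permRep_apply, Pi.single_apply, Pi.single_apply]
  simp [inv_smul_eq_iff]

theorem orbitSpace_invariant (q : MulAction.orbitRel.Quotient H X) (g : H) (f : X → ℂ)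
    (hf : f ∈ orbitSpace H q) : res (permRep G X) H g f ∈ orbitSpace H q := by
  intro x hx
  rw [res_permRep_apply]
  refine hf _ fun h => hx ?_
  rw [MulAction.orbitRel.Quotient.mem_orbit] at h ⊢
  rw [← h]
  exact Quotient.sound ⟨g, by simp [Subgroup.smul_def]⟩

theorem single_mem_orbitSpace [DecidableEq X] (x : X) :
    (Pi.single x 1 : X → ℂ) ∈ orbitSpace H (Quotient.mk'' x : MulAction.orbitRel.Quotient H X) := by
  intro y hy
  refine Pi.single_eq_of_ne (fun h => hy ?_) 1
  rw [h, MulAction.orbitRel.Quotient.mem_orbit]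

theorem mk_eq_of_mem_orbitSpace {q : MulAction.orbitRel.Quotient H X} {f : X → ℂ}
    (hf : f ∈ orbitSpace H q) {x : X} (hx : f x ≠ 0) : Quotient.mk'' x = q := by
  by_contra h
  exact hx (hf x fun h' => h ((MulAction.orbitRel.Quotient.mem_orbit).1 h'))

theorem eq_of_mem_orbitSpace {q q' : MulAction.orbitRel.Quotient H X} {f : X → ℂ} (h0 : f ≠ 0)
    (hf : f ∈ orbitSpace H q) (hf' : f ∈ orbitSpace H q') : q = q' := by
  obtain ⟨x, hx⟩ := Function.ne_iff.1 h0
  rw [← mk_eq_of_mem_orbitSpace hf hx, mk_eq_of_mem_orbitSpace hf' hx]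

/-- Two points in the same orbit are interchanged by an element of the group. -/
def SymmetricOrbits (H : Subgroup G) (X : Type*) [MulAction G X] : Prop :=
  ∀ x y : X, (Quotient.mk'' x : MulAction.orbitRel.Quotient H X) = Quotient.mk'' y →
    ∃ g : H, (g : G) • x = y ∧ (g : G) • y = x

/-- The vectors labelled `q` span the whole orbit space of `q`, so by uniqueness of coordinates a
function in it involves no other basis vectors. -/
theorem IsOrbitalHarmonic.exists_orbit {m : ℕ} {B : Basis (Fin m) ℂ (X → ℂ)}
    (hB : IsOrbitalHarmonic H B) : ∃ o : Fin m → MulAction.orbitRel.Quotient H X,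
      (∀ i, B i ∈ orbitSpace H (o i)) ∧
        ∀ q, ∀ f ∈ orbitSpace H q, ∀ i, B.repr f i ≠ 0 → o i = q := by
  obtain ⟨o, ho⟩ := hB
  refine ⟨o, fun i => ?_, fun q f hf i hi => ?_⟩
  · rw [← (ho (o i)).2.1]
    exact Submodule.subset_span ⟨⟨i, rfl⟩, rfl⟩
  · have h : Set.range (fun i : {i // o i = q} => B i) = B '' {i | o i = q} := by
      rw [Set.image_eq_range]
      rfl
    rw [← (ho q).2.1, h, Basis.mem_span_image] at hf
    exact hf (Finsupp.mem_support_iff.2 hi)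

theorem orbitSpace_mono {K : Subgroup G} (hHK : H ≤ K) (x : X) :
    orbitSpace H (Quotient.mk'' x) ≤ orbitSpace K (Quotient.mk'' x) := by
  intro f hf y hy
  refine hf y fun h => hy ?_
  rw [MulAction.orbitRel.Quotient.mem_orbit] at h ⊢
  obtain ⟨g, hg⟩ := Quotient.exact h
  exact Quotient.sound ⟨⟨g, hHK g.2⟩, hg⟩

variable [Fintype X] [DecidableEq X]

/-- An element interchanging `x` and `y` carries the entry at `(x, y)` to the one at `(y, x)`;
between different orbits both entries vanish. -/
theorem toMatrix_transpose_of_equivariant (hsym : SymmetricOrbits H X)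
    (F : (X → ℂ) →ₗ[ℂ] (X → ℂ))
    (hF : ∀ (g : H) f, F (res (permRep G X) H g f) = res (permRep G X) H g (F f))
    (hsupp : ∀ x y, F (Pi.single y 1) x ≠ 0 →
      (Quotient.mk'' x : MulAction.orbitRel.Quotient H X) = Quotient.mk'' y) :
    (LinearMap.toMatrix' F).transpose = LinearMap.toMatrix' F := by
  ext x y
  rw [Matrix.transpose_apply, LinearMap.toMatrix'_apply, LinearMap.toMatrix'_apply]
  by_cases h : (Quotient.mk'' x : MulAction.orbitRel.Quotient H X) = Quotient.mk'' y
  · obtain ⟨g, hx, hy⟩ := hsym x y h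
    have h1 := congrFun (hF g (Pi.single y 1)) y
    rwa [res_permRep_single, hy, res_permRep_apply, inv_smul_eq_iff.2 hx.symm] at h1
  · have h1 : F (Pi.single x 1) y = 0 := by
      by_contra h'
      exact h (hsupp _ _ h').symm
    have h2 : F (Pi.single y 1) x = 0 := by
      by_contra h'
      exact h (hsupp _ _ h')
    rw [h1, h2]

/-- Equivariant endomorphisms that respect the decomposition into orbits commute with each other
if the orbits are symmetric. -/
theorem comp_comm_of_equivariant (hsym : SymmetricOrbits H X)
    (F F' : (X → ℂ) →ₗ[ℂ] (X → ℂ))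
    (hF : ∀ (g : H) f, F (res (permRep G X) H g f) = res (permRep G X) H g (F f))
    (hF' : ∀ (g : H) f, F' (res (permRep G X) H g f) = res (permRep G X) H g (F' f))
    (hsupp : ∀ q : MulAction.orbitRel.Quotient H X, ∀ f ∈ orbitSpace H q, F f ∈ orbitSpace H q)
    (hsupp' : ∀ q : MulAction.orbitRel.Quotient H X, ∀ f ∈ orbitSpace H q,
      F' f ∈ orbitSpace H q) :
    F ∘ₗ F' = F' ∘ₗ F := by
  have h1 := toMatrix_transpose_of_equivariant hsym F hF fun x y =>
    mk_eq_of_mem_orbitSpace (hsupp _ _ (single_mem_orbitSpace y))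
  have h2 := toMatrix_transpose_of_equivariant hsym F' hF' fun x y =>
    mk_eq_of_mem_orbitSpace (hsupp' _ _ (single_mem_orbitSpace y))
  -- The composite is equivariant and orbit-preserving too, hence symmetric; two symmetric matrices
  -- with symmetric product commute.
  have h3 := toMatrix_transpose_of_equivariant hsym (F ∘ₗ F')
    (fun g f => by simp only [LinearMap.comp_apply, hF, hF']) fun x y =>
    mk_eq_of_mem_orbitSpace (hsupp _ _ (hsupp' _ _ (single_mem_orbitSpace y)))
  refine LinearMap.toMatrix'.injective ?_
  rw [← h3, LinearMap.toMatrix'_comp, LinearMap.toMatrix'_comp, Matrix.transpose_mul, h1, h2]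

/-- An orbital symmetry adapted basis contains at most one block of each type on each orbit. -/
theorem index_eq_of_label_eq (hsym : SymmetricOrbits H X) {t : ℕ} {σ : Fin t → MatrixRep H}
    {b : Basis (Σ s : Fin t, Fin (σ s).deg) ℂ (X → ℂ)}
    (hb : ∀ g, LinearMap.toMatrix b b (res (permRep G X) H g) =
      Matrix.blockDiagonal' fun s => (σ s).mat g)
    (hσ : ∀ s, (σ s).toRepresentation.IsIrreducible)
    {o : (Σ s : Fin t, Fin (σ s).deg) → MulAction.orbitRel.Quotient H X}
    (ho : ∀ x, b x ∈ orbitSpace H (o x))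
    (ho' : ∀ q, ∀ f ∈ orbitSpace H q, ∀ x, b.repr f x ≠ 0 → o x = q)
    {x y : Σ s : Fin t, Fin (σ s).deg} (hxy : o x = o y)
    (h : (⟨σ x.1, x.2⟩ : Σ ρ : MatrixRep H, Fin ρ.deg) = ⟨σ y.1, y.2⟩) : x = y := by
  classical
  obtain ⟨s, p⟩ := x
  obtain ⟨t, q⟩ := y
  by_cases hst : s = t
  · subst hst
    simpa using h
  exfalso
  obtain ⟨c, hc⟩ := MatrixRep.exists_cast h
  have hc' : ∀ g v, c.symm (((σ t).mat g).mulVec v) = ((σ s).mat g).mulVec (c.symm v) := by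
    intro g v
    rw [LinearEquiv.symm_apply_eq, hc, LinearEquiv.apply_symm_apply]
  have hs : ∀ p', b ⟨s, p'⟩ ∈ orbitSpace H (o ⟨s, p⟩) :=
    block_mem_of_mem hb (hσ s) (orbitSpace_invariant _) (ho ⟨s, p⟩)
  have ht : ∀ p', b ⟨t, p'⟩ ∈ orbitSpace H (o ⟨s, p⟩) :=
    block_mem_of_mem hb (hσ t) (orbitSpace_invariant _) (hxy ▸ ho ⟨t, q⟩)
  have mapmem : ∀ r, (∀ p', b ⟨r, p'⟩ ∈ orbitSpace H (o ⟨s, p⟩)) → ∀ v,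
      blockMap b r v ∈ orbitSpace H (o ⟨s, p⟩) := fun r hr v => by
    rw [blockMap, Fintype.linearCombination_apply]
    exact Submodule.sum_mem _ fun i _ => Submodule.smul_mem _ _ (hr i)
  have coord0 : ∀ r, (∀ p', b ⟨r, p'⟩ ∈ orbitSpace H (o ⟨s, p⟩)) →
      ∀ q' : MulAction.orbitRel.Quotient H X, o ⟨s, p⟩ ≠ q' → ∀ f ∈ orbitSpace H q',
        blockCoord b r f = 0 := fun r hr q' hq' f hf => by
    ext p'
    rw [blockCoord_apply]
    by_contra h'
    exact hq' ((eq_of_mem_orbitSpace (b.ne_zero _) (hr p') (ho _)).trans (ho' q' f hf _ h'))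
  -- The transfer map between the two blocks kills every other orbit space, so it respects the
  -- decomposition into orbits.
  have supp : ∀ r r' (c : (Fin (σ r).deg → ℂ) ≃ₗ[ℂ] (Fin (σ r').deg → ℂ)),
      (∀ p', b ⟨r, p'⟩ ∈ orbitSpace H (o ⟨s, p⟩)) →
      (∀ p', b ⟨r', p'⟩ ∈ orbitSpace H (o ⟨s, p⟩)) →
      ∀ q', ∀ f ∈ orbitSpace H q', blockMap b r' (c (blockCoord b r f)) ∈ orbitSpace H q' := by
    intro r r' c hr hr' q' f hf
    by_cases hq : o ⟨s, p⟩ = q'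
    · exact hq ▸ mapmem r' hr' _
    · rw [coord0 r hr q' hq f hf, map_zero, map_zero]
      exact Submodule.zero_mem _
  -- Transfers `s → t` and `t → s` between distinct isomorphic blocks do not commute: on a vector of
  -- block `t` one composite is the identity and the other is zero.
  have key := LinearMap.congr_fun (comp_comm_of_equivariant hsym
    (blockMap b t ∘ₗ c.toLinearMap ∘ₗ blockCoord b s)
    (blockMap b s ∘ₗ c.symm.toLinearMap ∘ₗ blockCoord b t)
    (fun g f => by simp [blockCoord_apply_rep hb, hc, apply_blockMap hb])
    (fun g f => by simp [blockCoord_apply_rep hb, hc', apply_blockMap hb])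
    (supp s t c hs ht) (supp t s c.symm ht hs)) (b ⟨t, q⟩)
  simp only [LinearMap.comp_apply, LinearEquiv.coe_coe, blockCoord_blockMap,
    LinearEquiv.apply_symm_apply, blockCoord_of_ne b hst, blockCoord_self, blockMap_single,
    map_zero] at key
  exact b.ne_zero _ key

/-- Change of basis between orbital symmetry adapted bases of a group and a subgroup. -/
theorem exists_two_of_changeOfBasis {m : ℕ} {K : Subgroup G} {R : Set (MatrixRep H)}
    (hR : IsCompleteSystem R) (hHK : H ≤ K) (hsym : SymmetricOrbits H X)
    (htwo : ∀ x y z : X, (Quotient.mk'' x : MulAction.orbitRel.Quotient K X) = Quotient.mk'' y →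
      (Quotient.mk'' x : MulAction.orbitRel.Quotient K X) = Quotient.mk'' z →
      (Quotient.mk'' x : MulAction.orbitRel.Quotient H X) = Quotient.mk'' y ∨
      (Quotient.mk'' x : MulAction.orbitRel.Quotient H X) = Quotient.mk'' z ∨
      (Quotient.mk'' y : MulAction.orbitRel.Quotient H X) = Quotient.mk'' z)
    {B B' : Basis (Fin m) ℂ (X → ℂ)}
    (hB : IsOrbitalHarmonic K B) (hB' : IsOrbitalHarmonic H B')
    (hBR : IsSymmetryAdapted R (res (permRep G X) H) B)
    (hBR' : IsSymmetryAdapted R (res (permRep G X) H) B') (i : Fin m) :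
    ∃ a d : Fin m, ∀ l, changeOfBasis B B' i l ≠ 0 → l = a ∨ l = d := by
  obtain ⟨o, ho, ho'⟩ := hB.exists_orbit
  obtain ⟨u, hu, hu'⟩ := hB'.exists_orbit
  obtain ⟨t, σ, e, hσ, hb⟩ := hBR
  obtain ⟨t', σ', e', hσ', hb'⟩ := hBR'
  have hC : ∀ l, changeOfBasis B B' i l = B.repr (B' l) i := fun l => rfl
  have label : ∀ l, changeOfBasis B B' i l ≠ 0 →
      (⟨σ (e i).1, (e i).2⟩ : Σ ρ : MatrixRep H, Fin ρ.deg) = ⟨σ' (e' l).1, (e' l).2⟩ := by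
    intro l hl
    refine label_eq_of_repr_ne_zero hR hσ hσ' hb hb' ?_
    simpa [hC] using hl
  have inj : ∀ l l', changeOfBasis B B' i l ≠ 0 → changeOfBasis B B' i l' ≠ 0 → u l = u l' →
      l = l' := by
    intro l l' hl hl' hll
    refine e'.injective (index_eq_of_label_eq hsym hb' (fun s => hR.irreducible _ (hσ' s))
      (o := fun x => u (e'.symm x)) (fun x => ?_) (fun q f hf x hx => ?_) (by simpa using hll)
      ((label l hl).symm.trans (label l' hl')))
    · rw [Basis.reindex_apply]
      exact hu _
    · exact hu' q f hf _ (by simpa using hx)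
  have orb : ∀ l, changeOfBasis B B' i l ≠ 0 → ∃ x, Quotient.mk'' x = u l ∧
      Quotient.mk'' x = o i := by
    intro l hl
    obtain ⟨x, hx⟩ := Function.ne_iff.1 (B'.ne_zero l)
    have h := mk_eq_of_mem_orbitSpace (hu l) hx
    have hu'' := hu l
    rw [← h] at hu''
    exact ⟨x, h, (ho' _ _ (orbitSpace_mono hHK x hu'') i hl).symm⟩
  -- Otherwise the row meets three distinct columns. Two of the three `H`-orbits inside the single
  -- `K`-orbit `o i` then coincide, contradicting `inj`. The arguments `i i` only start the
  -- extraction.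
  by_contra! hcon
  obtain ⟨a, ha, -⟩ := hcon i i
  obtain ⟨d, hd, hda, -⟩ := hcon a a
  obtain ⟨l, hl, hla, hld⟩ := hcon a d
  obtain ⟨x, hx, hx'⟩ := orb a ha
  obtain ⟨y, hy, hy'⟩ := orb d hd
  obtain ⟨z, hz, hz'⟩ := orb l hl
  rcases htwo x y z (hx'.trans hy'.symm) (hx'.trans hz'.symm) with h | h | h
  · exact hda (inj d a hd ha (by rw [← hx, ← hy, h]))
  · exact hla (inj l a hl ha (by rw [← hx, ← hz, h]))
  · exact hld (inj l d hl hd (by rw [← hy, ← hz, h]))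

end Kernels

/-! ### Two-row tabloids as subsets, and their orbits -/

section TwoRows

variable {n : ℕ} {α : Fin 2 → ℕ}

instance {r : ℕ} (α : Fin r → ℕ) (n : ℕ) : Finite (Tabloid α n) :=
  inferInstanceAs (Finite (Quotient (rowSetoid α n)))

theorem rowSet_zero (T : Tableau α n) : rowSet T 0 = (rowSet T 1)ᶜ := by
  ext a
  obtain ⟨⟨i, c⟩, rfl⟩ := T.surjective a
  simp only [rowSet, Set.mem_range, Set.mem_compl_iff, EmbeddingLike.apply_eq_iff_eq]
  fin_cases i
  · simp
  · simp

/-- The set of entries in the second row of a tabloid. -/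
def secondRow : Tabloid α n → Set (Fin n) :=
  Quotient.lift (s := rowSetoid α n) (fun T => rowSet T 1) fun _ _ h => h 1

theorem secondRow_injective : Function.Injective (secondRow : Tabloid α n → Set (Fin n)) := by
  intro x y
  refine Quotient.inductionOn₂ x y fun T T' (h : rowSet T 1 = rowSet T' 1) => Quotient.sound ?_
  intro i
  fin_cases i
  · exact (rowSet_zero T).trans ((congrArg _ h).trans (rowSet_zero T').symm)
  · exact h

theorem secondRow_smul (g : Equiv.Perm (Fin n)) (x : Tabloid α n) :
    secondRow (g • x) = g '' secondRow x := by
  refine Quotient.inductionOn x fun T => ?_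
  exact rowSet_trans T g 1

theorem ncard_secondRow (x : Tabloid α n) : (secondRow x).ncard = α 1 := by
  refine Quotient.inductionOn x fun T => ?_
  have : Function.Injective fun c : Fin (α 1) => T ⟨1, c⟩ := fun c c' h => by
    simpa using T.injective h
  change (Set.range fun c : Fin (α 1) => T ⟨1, c⟩).ncard = α 1
  rw [← Set.image_univ, Set.ncard_image_of_injective _ this, Set.ncard_univ, Nat.card_fin]

/-- Injectivity of `secondRow` is enough here, since the operation count needs only an upper bound.
-/
theorem card_tabloid_le : Nat.card (Tabloid α n) ≤ n.choose (α 1) := by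
  classical
  have := Nat.card_le_card_of_injective
    (fun x : Tabloid α n => (⟨(secondRow x).toFinset, by
      rw [Finset.mem_powersetCard, ← Set.ncard_eq_toFinset_card', ncard_secondRow]
      exact ⟨Finset.subset_univ _, rfl⟩⟩ :
      {s // s ∈ Finset.powersetCard (α 1) (Finset.univ : Finset (Fin n))}))
    (fun x y h => secondRow_injective (by simpa using h))
  simpa using this

theorem mem_symSubgroup {j : ℕ} {g : Equiv.Perm (Fin n)} :
    g ∈ symSubgroup n j ↔ ∀ i : Fin n, j ≤ (i : ℕ) → g i = i := by
  simp [symSubgroup, mem_fixingSubgroup_iff]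

theorem symSubgroup_mono {j j' : ℕ} (h : j ≤ j') : symSubgroup n j ≤ symSubgroup n j' := by
  intro g hg
  rw [mem_symSubgroup] at hg ⊢
  exact fun i hi => hg i (h.trans hi)

/-- Two sets of the same size are interchanged by a permutation that moves only elements of their
symmetric difference. -/
theorem exists_perm_interchanging {β : Type*} [Finite β] {A A' : Set β} (h : A.ncard = A'.ncard) :
    ∃ g : Equiv.Perm β, g '' A = A' ∧ g '' A' = A ∧ ∀ i, (i ∈ A ↔ i ∈ A') → g i = i := by
  classical
  have hcard : (A \ A').ncard = (A' \ A).ncard := by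
    have h1 := Set.ncard_inter_add_ncard_sdiff_eq_ncard A A'
    have h2 := Set.ncard_inter_add_ncard_sdiff_eq_ncard A' A
    rw [Set.inter_comm] at h2
    omega
  obtain ⟨e⟩ : Nonempty ((A \ A' : Set β) ≃ (A' \ A : Set β)) := by
    rw [← Nat.card_coe_set_eq, ← Nat.card_coe_set_eq] at hcard
    exact Finite.card_eq.1 hcard
  -- A bijection between the two differences, applied in both directions, gives an involution; this
  -- is why one permutation serves both ways.
  let f : β → β := fun i =>
    if h : i ∈ A \ A' then e ⟨i, h⟩ else if h' : i ∈ A' \ A then e.symm ⟨i, h'⟩ else i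
  have f1 : ∀ i (h : i ∈ A \ A'), f i = e ⟨i, h⟩ := fun i h => dif_pos h
  have f2 : ∀ i (h : i ∈ A' \ A), f i = e.symm ⟨i, h⟩ := fun i h =>
    (dif_neg fun h' => h.2 h'.1).trans (dif_pos h)
  have f3 : ∀ i, (i ∈ A ↔ i ∈ A') → f i = i := fun i h =>
    (dif_neg fun h' => h'.2 (h.1 h'.1)).trans (dif_neg fun h' => h'.2 (h.2 h'.1))
  have inv : Function.Involutive f := by
    intro i
    by_cases h1 : i ∈ A \ A'
    · rw [f1 i h1, f2 _ (e ⟨i, h1⟩).2]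
      simp
    by_cases h2 : i ∈ A' \ A
    · rw [f2 i h2, f1 _ (e.symm ⟨i, h2⟩).2]
      simp
    · have : i ∈ A ↔ i ∈ A' := by
        simp only [Set.mem_sdiff] at h1 h2
        tauto
      rw [f3 i this, f3 i this]
  have m1 : ∀ i ∈ A, f i ∈ A' := by
    intro i hi
    by_cases h1 : i ∈ A'
    · rwa [f3 i ⟨fun _ => h1, fun _ => hi⟩]
    · rw [f1 i ⟨hi, h1⟩]
      exact (e _).2.1
  have m2 : ∀ i ∈ A', f i ∈ A := by
    intro i hi
    by_cases h1 : i ∈ A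
    · rwa [f3 i ⟨fun _ => hi, fun _ => h1⟩]
    · rw [f2 i ⟨hi, h1⟩]
      exact (e.symm _).2.1
  refine ⟨inv.toPerm, ?_, ?_, f3⟩
  · refine Set.Subset.antisymm (Set.image_subset_iff.2 m1) fun i hi => ⟨f i, m2 i hi, inv i⟩
  · refine Set.Subset.antisymm (Set.image_subset_iff.2 m2) fun i hi => ⟨f i, m1 i hi, inv i⟩

theorem exists_interchanging {j : ℕ} {x y : Tabloid α n}
    (h : ∀ i : Fin n, j ≤ (i : ℕ) → (i ∈ secondRow x ↔ i ∈ secondRow y)) :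
    ∃ g : symSubgroup n j, (g : Equiv.Perm (Fin n)) • x = y ∧
      (g : Equiv.Perm (Fin n)) • y = x := by
  obtain ⟨g, h1, h2, h3⟩ := exists_perm_interchanging
    ((ncard_secondRow x).trans (ncard_secondRow y).symm)
  exact ⟨⟨g, mem_symSubgroup.2 fun i hi => h3 i (h i hi)⟩,
    secondRow_injective ((secondRow_smul g x).trans h1),
    secondRow_injective ((secondRow_smul g y).trans h2)⟩

/-- `S_j` fixes the indices from `j` on (counted from zero) and can rearrange the rest freely; the
size of the second row is fixed, so its trace on those indices determines the orbit. -/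
theorem orbit_eq_iff {j : ℕ} {x y : Tabloid α n} :
    (Quotient.mk'' x : MulAction.orbitRel.Quotient (symSubgroup n j) (Tabloid α n)) =
      Quotient.mk'' y ↔
    ∀ i : Fin n, j ≤ (i : ℕ) → (i ∈ secondRow x ↔ i ∈ secondRow y) := by
  constructor
  · intro h i hi
    obtain ⟨g, hg⟩ := Quotient.exact h
    have hx : secondRow x = (g : Equiv.Perm (Fin n)) '' secondRow y := by
      rw [← secondRow_smul, ← hg]
      rfl
    rw [hx, ← (g : Equiv.Perm (Fin n)).injective.mem_set_image (s := secondRow y),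
      mem_symSubgroup.1 g.2 i hi]
  · intro h
    obtain ⟨g, -, hg⟩ := exists_interchanging h
    exact Quotient.sound ⟨g, hg⟩

theorem symmetricOrbits_symSubgroup (j : ℕ) :
    SymmetricOrbits (symSubgroup n j) (Tabloid α n) :=
  fun _ _ h => exists_interchanging (orbit_eq_iff.1 h)

/-- An orbit of `S_{j+1}` on tabloids with two rows splits into at most two orbits of `S_j`. -/
theorem orbit_eq_or_orbit_eq {j : ℕ} (hj : j < n) (x y z : Tabloid α n)
    (hy : (Quotient.mk'' x : MulAction.orbitRel.Quotient (symSubgroup n (j + 1)) (Tabloid α n)) =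
      Quotient.mk'' y)
    (hz : (Quotient.mk'' x : MulAction.orbitRel.Quotient (symSubgroup n (j + 1)) (Tabloid α n)) =
      Quotient.mk'' z) :
    (Quotient.mk'' x : MulAction.orbitRel.Quotient (symSubgroup n j) (Tabloid α n)) =
      Quotient.mk'' y ∨
    (Quotient.mk'' x : MulAction.orbitRel.Quotient (symSubgroup n j) (Tabloid α n)) =
      Quotient.mk'' z ∨
    (Quotient.mk'' y : MulAction.orbitRel.Quotient (symSubgroup n j) (Tabloid α n)) =
      Quotient.mk'' z := by
  have step : ∀ v w : Tabloid α n,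
      (∀ i : Fin n, j + 1 ≤ (i : ℕ) → (i ∈ secondRow v ↔ i ∈ secondRow w)) →
      ((⟨j, hj⟩ : Fin n) ∈ secondRow v ↔ (⟨j, hj⟩ : Fin n) ∈ secondRow w) →
      ∀ i : Fin n, j ≤ (i : ℕ) → (i ∈ secondRow v ↔ i ∈ secondRow w) := by
    intro v w h h' i hi
    rcases hi.eq_or_lt with hi | hi
    · obtain rfl : i = ⟨j, hj⟩ := Fin.ext hi.symm
      exact h'
    · exact h i hi
  rw [orbit_eq_iff] at hy hz
  simp only [orbit_eq_iff]
  have hyz : ∀ i : Fin n, j + 1 ≤ (i : ℕ) → (i ∈ secondRow y ↔ i ∈ secondRow z) :=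
    fun i hi => (hy i hi).symm.trans (hz i hi)
  -- Only membership of the index `j` is still free, and among three yes-or-no answers two agree.
  by_cases h1 : (⟨j, hj⟩ : Fin n) ∈ secondRow x ↔ (⟨j, hj⟩ : Fin n) ∈ secondRow y
  · exact Or.inl (step x y hy h1)
  by_cases h2 : (⟨j, hj⟩ : Fin n) ∈ secondRow x ↔ (⟨j, hj⟩ : Fin n) ∈ secondRow z
  · exact Or.inr (Or.inl (step x z hz h2))
  · exact Or.inr (Or.inr (step y z hyz (by tauto)))

end TwoRows

/-! ### Straight-line cost of sparse factorizations -/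

section OperationCount

variable {ι : Type*}

theorem Computes.exists_combination {s : ℕ} {S : Set ((ι → ℂ) → ℂ)} (h : Computes s S)
    {f g : (ι → ℂ) → ℂ} (hf : f ∈ S) (hg : g ∈ S) (c d : ℂ) :
    ∃ S', Computes (s + 3) S' ∧ S ⊆ S' ∧ (fun x => c * f x + d * g x) ∈ S' := by
  refine ⟨_, ((h.mul c hf).mul d (Set.mem_insert_of_mem _ hg)).add
    (Set.mem_insert_of_mem _ (Set.mem_insert _ _)) (Set.mem_insert _ _), ?_, Set.mem_insert _ _⟩
  exact ((Set.subset_insert _ _).trans (Set.subset_insert _ _)).trans (Set.subset_insert _ _)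

/-- A family of linear combinations of two available quantities each is computed with three
operations per member. -/
theorem Computes.exists_combinations {s : ℕ} {S : Set ((ι → ℂ) → ℂ)} (h : Computes s S) {κ : Type*}
    (F : κ → (ι → ℂ) → ℂ)
    (hF : ∀ i, ∃ f ∈ S, ∃ g ∈ S, ∃ c d : ℂ, F i = fun x => c * f x + d * g x) (I : Finset κ) :
    ∃ S', Computes (s + 3 * I.card) S' ∧ S ⊆ S' ∧ ∀ i ∈ I, F i ∈ S' := by
  classical
  induction I using Finset.induction_on with
  | empty => exact ⟨S, h, subset_rfl, by simp⟩
  | insert i I hi ih =>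
    obtain ⟨S₁, h₁, hS, hI⟩ := ih
    obtain ⟨f, hf, g, hg, c, d, hi'⟩ := hF i
    obtain ⟨S₂, h₂, hS', hi''⟩ := h₁.exists_combination (hS hf) (hS hg) c d
    refine ⟨S₂, ?_, hS.trans hS', fun l hl => ?_⟩
    · rw [Finset.card_insert_of_notMem hi, mul_add, mul_one, ← add_assoc]
      exact h₂
    · rcases Finset.mem_insert.1 hl with rfl | hl
      · rw [hi']
        exact hi''
      · exact hS' (hI l hl)

theorem omega_le {m s : ℕ} {A : Matrix (Fin m) (Fin m) ℂ} {S : Set ((Fin m → ℂ) → ℂ)}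
    (h : Computes s S) (hA : ∀ i, (fun x => A.mulVec x i) ∈ S) : omega A ≤ s :=
  iInf₂_le s ⟨S, h, hA⟩

theorem mulVec_eq_of_two {m : ℕ} (A : Matrix (Fin m) (Fin m) ℂ) {i a d : Fin m}
    (h : ∀ l, A i l ≠ 0 → l = a ∨ l = d) :
    ∃ c c' : ℂ, ∀ x, A.mulVec x i = c * x a + c' * x d := by
  have h0 : ∀ l, l ≠ a → l ≠ d → A i l = 0 := fun l h1 h2 => by
    by_contra h'
    exact (h l h').elim h1 h2
  -- A row with one possible column is padded with coefficient zero, so that all rows have the same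
  -- form and cost.
  by_cases had : a = d
  · subst had
    refine ⟨A i a, 0, fun x => ?_⟩
    rw [Matrix.mulVec, dotProduct, Finset.sum_eq_single a, zero_mul, add_zero]
    · intro l _ hl
      rw [h0 l hl hl, zero_mul]
    · simp
  · refine ⟨A i a, A i d, fun x => ?_⟩
    rw [Matrix.mulVec, dotProduct, Finset.sum_eq_add_of_mem a d (Finset.mem_univ _)
      (Finset.mem_univ _) had]
    intro l _ hl
    rw [h0 l hl.1 hl.2, zero_mul]

theorem changeOfBasis_mul {V : Type*} [AddCommGroup V] [Module ℂ V] {m : ℕ}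
    (B B' B'' : Basis (Fin m) ℂ V) :
    changeOfBasis B B' * changeOfBasis B' B'' = changeOfBasis B B'' :=
  Basis.toMatrix_mul_toMatrix B B' B''

theorem changeOfBasis_self {V : Type*} [AddCommGroup V] [Module ℂ V] {m : ℕ}
    (B : Basis (Fin m) ℂ V) : changeOfBasis B B = 1 :=
  Basis.toMatrix_self B

/-- A change of basis that is carried out in steps, whose matrices have at most two nonzero
entries in each row, costs at most three operations per basis vector and step. -/
theorem omega_changeOfBasis_le {V : Type*} [AddCommGroup V] [Module ℂ V] {m n : ℕ}
    (B : ℕ → Basis (Fin m) ℂ V)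
    (h : ∀ j < n, ∀ i, ∃ a d : Fin m, ∀ l, changeOfBasis (B (j + 1)) (B j) i l ≠ 0 →
      l = a ∨ l = d) :
    omega (changeOfBasis (B n) (B 0)) ≤ ((3 * n * m : ℕ) : ℕ∞) := by
  have main : ∀ j ≤ n, ∃ S, Computes (3 * j * m) S ∧
      ∀ i, (fun x => (changeOfBasis (B j) (B 0)).mulVec x i) ∈ S := by
    intro j hj
    induction j with
    | zero =>
      refine ⟨Set.range fun (i : Fin m) (x : Fin m → ℂ) => x i, ?_, fun i => ⟨i, ?_⟩⟩
      · rw [mul_zero, zero_mul]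
        exact Computes.input
      · rw [changeOfBasis_self]
        simp
    | succ j ih =>
      obtain ⟨S, hS, hmem⟩ := ih (by omega)
      obtain ⟨S', hS', -, hmem'⟩ := hS.exists_combinations
        (fun i x => (changeOfBasis (B (j + 1)) (B 0)).mulVec x i) (fun i => by
          obtain ⟨a, d, had⟩ := h j hj i
          obtain ⟨c, c', hc⟩ := mulVec_eq_of_two _ had
          refine ⟨_, hmem a, _, hmem d, c, c', funext fun x => ?_⟩
          rw [← hc, Matrix.mulVec_mulVec, changeOfBasis_mul]) Finset.univ
      refine ⟨S', ?_, fun i => hmem' i (Finset.mem_univ i)⟩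
      convert hS' using 1
      rw [Finset.card_univ, Fintype.card_fin]
      ring
  obtain ⟨S, hS, hmem⟩ := main n le_rfl
  exact omega_le hS hmem

end OperationCount

end

end HarmonicTabloids

/-! ### Assembly along the chain of groups -/

theorem theorem13 (n k m : ℕ) (hn : 2 ≤ n) (hk : 2 * k ≤ n)
    (R : ∀ j : ℕ, Set (HarmonicTabloids.MatrixRep (HarmonicTabloids.symSubgroup n j)))
    (hR : ∀ j, 1 ≤ j → j ≤ n → HarmonicTabloids.IsCompleteSystem (R j))
    (hcompat : HarmonicTabloids.IsCompatible (HarmonicTabloids.symSubgroup n) R n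
      (HarmonicTabloids.permRep (Equiv.Perm (Fin n))
        (HarmonicTabloids.Tabloid ![n - k, k] n)))
    (B : ℕ → Module.Basis (Fin m) ℂ (HarmonicTabloids.Tabloid ![n - k, k] n → ℂ))
    (hB : ∀ j, 1 ≤ j → j ≤ n →
      HarmonicTabloids.IsOrbitalSymmetryAdapted (HarmonicTabloids.symSubgroup n) R j (B j))
    (hB1 : HarmonicTabloids.IsStandardBasis (B 1)) :
    HarmonicTabloids.omega (HarmonicTabloids.changeOfBasis (B n) (B 1)) <
      ((4 * (n - 1) * n.choose k : ℕ) : ℕ∞) := by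
  classical
  have := Fintype.ofFinite (HarmonicTabloids.Tabloid ![n - k, k] n)
  have hm : m ≤ n.choose k := by
    obtain ⟨e, -⟩ := hB1
    have h := HarmonicTabloids.card_tabloid_le (n := n) (α := ![n - k, k])
    rw [← Nat.card_congr e, Nat.card_fin] at h
    exact h
  obtain ⟨N, rfl⟩ : ∃ N, n = N + 1 := ⟨n - 1, by omega⟩
  -- The index shift starts the chain at `B 1`, leaving `N = n - 1` steps.
  refine (HarmonicTabloids.omega_changeOfBasis_le (n := N) (fun j => B (j + 1))
    fun j hj i => ?_).trans_lt ?_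
  · have h1 := hB (j + 1) (by omega) (by omega)
    have h2 := hB (j + 1 + 1) (by omega) (by omega)
    exact HarmonicTabloids.exists_two_of_changeOfBasis (hR (j + 1) (by omega) (by omega))
      (HarmonicTabloids.symSubgroup_mono (by omega))
      (HarmonicTabloids.symmetricOrbits_symSubgroup _)
      (HarmonicTabloids.orbit_eq_or_orbit_eq (by omega))
      h2.1 h1.1 (h2.2 (j + 1) (by omega) (by omega)) (h1.2 (j + 1) (by omega) le_rfl) i
  -- Strictness comes from `3 < 4`, with `N` positive because `2 ≤ n`.
  · have hpos : 0 < (N + 1).choose k := Nat.choose_pos (by omega)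
    rw [Nat.cast_lt, Nat.add_sub_cancel]
    calc 3 * N * m ≤ 3 * N * (N + 1).choose k := Nat.mul_le_mul_left _ hm
      _ < 4 * N * (N + 1).choose k := Nat.mul_lt_mul_of_pos_right (by omega) hpos
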